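/- Let $n\ge 1$ and let $A=(A_{ij})\in M_n(\mathbb{C})$ be a complex $n\times n$ matrix. Suppose there is a constant $0<c<+\infty$ such that $$|\operatorname{Im}(A_{ij}\overline{A_{kl}})| < c \le \operatorname{Re}(A_{ij}\overline{A_{kl}})\qquad\text{for all } i,j,k,l\in\{1,\dots,n\}.$$ Then $A$ has a spectral gap: $A$ has an algebraically simple eigenvalue $\lambda\in\mathbb{C}$ whose modulus equals the spectral radius $r_{\mathrm{sp}}(A)$, and all the remaining eigenvalues of $A$ are contained in a disk centered at $0$ of radius strictly smaller than $r_{\mathrm{sp}}(A)$. -/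

import Mathlib

open scoped NNReal ENNReal ComplexConjugate

/-- A complex square matrix `A` has a spectral gap if it has an (algebraically) simple eigenvalue
`ev` whose modulus equals the spectral radius of `A`, and the rest of the spectrum is contained in
a disk centered at zero of radius strictly smaller than the spectral radius. (The eigenvalue `ev`
is then automatically isolated in the spectrum.) -/
def Matrix.HasSpectralGap {n : ℕ} (A : Matrix (Fin n) (Fin n) ℂ) : Prop :=
  ∃ ev : ℂ,
    (Module.End.HasEigenvalue (Matrix.toLin' A) ev ∧ A.charpoly.rootMultiplicity ev = 1) ∧
    (‖ev‖₊ : ℝ≥0∞) = spectralRadius ℂ A ∧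
    ∃ r : ℝ≥0, (r : ℝ≥0∞) < spectralRadius ℂ A ∧ ∀ μ ∈ spectrum ℂ A \ {ev}, ‖μ‖₊ ≤ r

/-! This is a Perron–Frobenius argument with the complex orthant in place of the positive cone. The
bounds on `A` make it map nonzero orthant vectors into the open orthant
(`mulVec_mem_openComplexOrthant`), because the sum of all `|Im (u j * conj (u l))|` never exceeds
the corresponding sum of real parts (`sum_abs_im_le`).

Such a map has an eigenvector in the open orthant: a complex line through a recurrent vector meets
the orthant in a clopen set of parameters, yet orthant vectors of coordinate sum 1 are bounded, so
the line is degenerate. The transpose satisfies the same bounds, which yields a left eigenvector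
`l`. Pairing with `l` vanishes on eigenvectors for every other eigenvalue, and on its kernel
eigenvalues have smaller modulus (`norm_lt_of_dotProduct_eq_zero`); this gives both the gap and
simplicity. -/

section ComplexOrthant

variable {ι : Type*}

/-- The canonical complex cone: vectors whose coordinates pairwise make an angle at most `π / 2`. -/
def complexOrthant (ι : Type*) : Set (ι → ℂ) :=
  {u | ∀ i j, 0 ≤ (u i * conj (u j)).re}

/-- The vectors whose coordinates pairwise make an angle less than `π / 2`. -/
def openComplexOrthant (ι : Type*) : Set (ι → ℂ) :=
  {u | ∀ i j, 0 < (u i * conj (u j)).re}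

lemma openComplexOrthant_subset : openComplexOrthant ι ⊆ complexOrthant ι :=
  fun _ hu i j => (hu i j).le

lemma isClosed_complexOrthant : IsClosed (complexOrthant ι) := by
  simp only [complexOrthant, Set.ofPred_forall]
  exact isClosed_iInter fun i => isClosed_iInter fun j =>
    isClosed_le continuous_const (by fun_prop)

lemma isOpen_openComplexOrthant [Finite ι] : IsOpen (openComplexOrthant ι) := by
  simp only [openComplexOrthant, Set.ofPred_forall]
  exact isOpen_iInter_of_finite fun i => isOpen_iInter_of_finite fun j =>
    isOpen_lt continuous_const (by fun_prop)

lemma re_smul_mul_conj_smul (a z w : ℂ) :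
    ((a * z) * conj (a * w)).re = Complex.normSq a * (z * conj w).re := by
  simp only [map_mul, Complex.mul_re, Complex.mul_im, Complex.conj_re, Complex.conj_im,
    Complex.normSq_apply]
  ring

lemma smul_mem_complexOrthant {u : ι → ℂ} (hu : u ∈ complexOrthant ι) (a : ℂ) :
    a • u ∈ complexOrthant ι := fun i j => by
  rw [Pi.smul_apply, Pi.smul_apply, smul_eq_mul, smul_eq_mul, re_smul_mul_conj_smul]
  exact mul_nonneg (Complex.normSq_nonneg a) (hu i j)

lemma smul_mem_openComplexOrthant {u : ι → ℂ} (hu : u ∈ openComplexOrthant ι) {a : ℂ}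
    (ha : a ≠ 0) : a • u ∈ openComplexOrthant ι := fun i j => by
  rw [Pi.smul_apply, Pi.smul_apply, smul_eq_mul, smul_eq_mul, re_smul_mul_conj_smul]
  exact mul_pos (Complex.normSq_pos.2 ha) (hu i j)

lemma im_mul_conj_eq_sin (a b : ℂ) :
    (a * conj b).im = ‖a‖ * ‖b‖ * Real.sin (a.arg - b.arg) := by
  rw [Real.sin_sub, Complex.mul_im, Complex.conj_re, Complex.conj_im]
  linear_combination (-‖b‖ * Real.cos b.arg) * Complex.norm_mul_sin_arg a +
    (‖b‖ * Real.sin b.arg) * Complex.norm_mul_cos_arg a -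
    a.im * Complex.norm_mul_cos_arg b + a.re * Complex.norm_mul_sin_arg b

/-- After multiplication by a suitable scalar, a vector of the complex orthant has all its
coordinates in the closed first quadrant. -/
lemma exists_forall_im_nonneg [Finite ι] {u : ι → ℂ} (hu : u ∈ complexOrthant ι) (hu0 : u ≠ 0) :
    ∃ m, u m ≠ 0 ∧ ∀ j, 0 ≤ (u j * conj (u m)).im := by
  obtain ⟨k, hk⟩ := Function.ne_iff.1 hu0
  -- Relative to `u k` all arguments lie in `[-π/2, π/2]`. Rotating by the smallest one puts them
  -- all in `[0, π]`.
  obtain ⟨m, hm, hmin⟩ := Set.exists_min_image {j | u j ≠ 0}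
    (fun j => (u j * conj (u k)).arg) (Set.toFinite _) ⟨k, hk⟩
  refine ⟨m, hm, fun j => ?_⟩
  rcases eq_or_ne (u j) 0 with hj | hj
  · simp [hj]
  have h1 := Complex.abs_arg_le_pi_div_two_iff.2 (hu j k)
  have h2 := Complex.abs_arg_le_pi_div_two_iff.2 (hu m k)
  have h3 := hmin j hj
  have h4 : 0 ≤ ((u j * conj (u k)) * conj (u m * conj (u k))).im := by
    rw [im_mul_conj_eq_sin]
    refine mul_nonneg (by positivity) (Real.sin_nonneg_of_nonneg_of_le_pi (by linarith) ?_)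
    linarith [(abs_le.1 h1).2, (abs_le.1 h2).1]
  have h5 : ((u j * conj (u k)) * conj (u m * conj (u k))).im =
      Complex.normSq (u k) * (u j * conj (u m)).im := by
    simp only [map_mul, Complex.mul_re, Complex.mul_im, Complex.conj_re, Complex.conj_im,
      Complex.normSq_apply]
    ring
  rw [h5] at h4
  exact nonneg_of_mul_nonneg_right h4 (Complex.normSq_pos.2 hk)

variable [Fintype ι]

lemma normSq_sum_eq (u : ι → ℂ) :
    Complex.normSq (∑ i, u i) = ∑ j, ∑ l, (u j * conj (u l)).re := by
  rw [← Complex.ofReal_re (Complex.normSq _), ← Complex.mul_conj, map_sum, Finset.sum_mul_sum]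
  simp only [Complex.re_sum]

/-- `‖∑ u‖²` expands into nonnegative terms, one of which is `‖u i‖²`. -/
lemma norm_apply_le_norm_sum {u : ι → ℂ} (hu : u ∈ complexOrthant ι) (i : ι) :
    ‖u i‖ ≤ ‖∑ j, u j‖ := by
  refine le_of_sq_le_sq ?_ (norm_nonneg _)
  rw [Complex.sq_norm, Complex.sq_norm, normSq_sum_eq]
  calc Complex.normSq (u i) = (u i * conj (u i)).re := by simp [Complex.mul_conj]
    _ ≤ ∑ l, (u i * conj (u l)).re :=
        Finset.single_le_sum (f := fun l => (u i * conj (u l)).re) (fun l _ => hu i l)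
          (Finset.mem_univ i)
    _ ≤ _ := Finset.single_le_sum (f := fun j => ∑ l, (u j * conj (u l)).re)
          (fun j _ => Finset.sum_nonneg fun l _ => hu j l) (Finset.mem_univ i)

lemma sum_ne_zero_of_mem_complexOrthant {u : ι → ℂ} (hu : u ∈ complexOrthant ι) (hu0 : u ≠ 0) :
    ∑ i, u i ≠ 0 := by
  intro h
  refine hu0 (funext fun i => norm_le_zero_iff.1 ?_)
  simpa [h] using norm_apply_le_norm_sum hu i

/-- Rotated into the first quadrant, `u` has coordinates `x + iy` with `x, y ≥ 0`. Then `|Im|` is at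
most `y j * x l + x j * y l`, and the claim becomes `2XY ≤ X² + Y²` for the sums `X`, `Y`. -/
lemma sum_abs_im_le {u : ι → ℂ} (hu : u ∈ complexOrthant ι) :
    ∑ j, ∑ l, |(u j * conj (u l)).im| ≤ Complex.normSq (∑ i, u i) := by
  rcases eq_or_ne u 0 with rfl | hu0
  · simp
  obtain ⟨m, hm, him⟩ := exists_forall_im_nonneg hu hu0
  set x : ι → ℝ := fun j => (u j * conj (u m)).re
  set y : ι → ℝ := fun j => (u j * conj (u m)).im
  have hx : ∀ j, 0 ≤ x j := fun j => hu j m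
  have hy : ∀ j, 0 ≤ y j := him
  have hpos := Complex.normSq_pos.2 hm
  refine le_of_mul_le_mul_left ?_ hpos
  have key : ∀ j l, Complex.normSq (u m) * |(u j * conj (u l)).im| ≤ y j * x l + x j * y l := by
    intro j l
    have : Complex.normSq (u m) * (u j * conj (u l)).im = y j * x l - x j * y l := by
      simp only [x, y, Complex.mul_re, Complex.mul_im, Complex.conj_re, Complex.conj_im,
        Complex.normSq_apply]
      ring
    rw [← abs_of_pos hpos, ← abs_mul, this, abs_le]
    have := mul_nonneg (hy j) (hx l)
    have := mul_nonneg (hx j) (hy l)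
    constructor <;> linarith
  have hS : Complex.normSq (u m) * Complex.normSq (∑ i, u i) = (∑ i, x i) ^ 2 + (∑ i, y i) ^ 2 := by
    rw [← Complex.normSq_conj (u m), mul_comm, ← Complex.normSq_mul, Finset.sum_mul,
      Complex.normSq_apply, Complex.re_sum, Complex.im_sum, sq, sq]
  rw [hS, Finset.mul_sum]
  calc ∑ j, Complex.normSq (u m) * ∑ l, |(u j * conj (u l)).im|
      ≤ ∑ j, ∑ l, (y j * x l + x j * y l) := by
        simp only [Finset.mul_sum]
        exact Finset.sum_le_sum fun j _ => Finset.sum_le_sum fun l _ => key j l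
    _ = 2 * (∑ i, x i) * ∑ i, y i := by
        simp only [Finset.sum_add_distrib, ← Finset.mul_sum, ← Finset.sum_mul]
        ring
    _ ≤ _ := two_mul_le_add_sq _ _

/-- A bilinear pairing of an open with a closed complex orthant does not vanish. -/
lemma dotProduct_ne_zero {l u : ι → ℂ} (hl : l ∈ openComplexOrthant ι)
    (hu : u ∈ complexOrthant ι) (hu0 : u ≠ 0) : l ⬝ᵥ u ≠ 0 := by
  intro h
  obtain ⟨m, hm, him⟩ := exists_forall_im_nonneg hu hu0
  have hl0 : l ≠ 0 := fun h0 => by simpa [h0] using hl m m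
  obtain ⟨k, hk, hik⟩ := exists_forall_im_nonneg (openComplexOrthant_subset hl) hl0
  have hsum : ∑ j, (l j * conj (l k)) * (u j * conj (u m)) = 0 := by
    calc _ = ∑ j, (l j * u j) * (conj (l k) * conj (u m)) :=
          Finset.sum_congr rfl fun j _ => by ring
      _ = 0 := by rw [← Finset.sum_mul]; exact mul_eq_zero_of_left h _
  -- With both vectors in the first quadrant, the imaginary part of the pairing is a sum of
  -- nonnegative terms, so each is zero. The real parts from `l` are strictly positive, which forces
  -- `u` to be real; the real part of the pairing then kills `u m`.
  have hterm : ∀ j, (u j * conj (u m)).im = 0 := by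
    have h1 := congrArg Complex.im hsum
    rw [Complex.im_sum, Complex.zero_im, Finset.sum_eq_zero_iff_of_nonneg] at h1
    · intro j
      have h2 := h1 j (Finset.mem_univ j)
      rw [Complex.mul_im] at h2
      have h3 := mul_nonneg (hik j) (hu j m)
      have h4 := mul_nonneg (hl j k).le (him j)
      have h5 : (l j * conj (l k)).re * (u j * conj (u m)).im = 0 := by linarith
      exact (mul_eq_zero.1 h5).resolve_left (hl j k).ne'
    · intro j _
      rw [Complex.mul_im]
      exact add_nonneg (mul_nonneg (hl j k).le (him j)) (mul_nonneg (hik j) (hu j m))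
  have h1 := congrArg Complex.re hsum
  simp only [Complex.re_sum, Complex.zero_re, Complex.mul_re _ (u _ * _), hterm, mul_zero,
    sub_zero] at h1
  rw [Finset.sum_eq_zero_iff_of_nonneg fun j _ => mul_nonneg (hl j k).le (hu j m)] at h1
  have h2 := (mul_eq_zero.1 (h1 m (Finset.mem_univ m))).resolve_left (hl m k).ne'
  rw [Complex.mul_conj, Complex.ofReal_re] at h2
  exact hm (Complex.normSq_eq_zero.1 h2)

/-- The matrices under consideration map the nonzero vectors of the complex orthant into the
open orthant. -/
lemma mulVec_mem_openComplexOrthant {A : Matrix ι ι ℂ} {c : ℝ} (hc : 0 < c)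
    (hA : ∀ i j k l, |(A i j * conj (A k l)).im| < c ∧ c ≤ (A i j * conj (A k l)).re)
    {u : ι → ℂ} (hu : u ∈ complexOrthant ι) (hu0 : u ≠ 0) :
    A.mulVec u ∈ openComplexOrthant ι := by
  intro i k
  have hexp : (A.mulVec u i * conj (A.mulVec u k)).re = ∑ j, ∑ l,
      ((A i j * conj (A k l)).re * (u j * conj (u l)).re -
        (A i j * conj (A k l)).im * (u j * conj (u l)).im) := by
    simp only [Matrix.mulVec, dotProduct, map_sum, Finset.sum_mul_sum, Complex.re_sum]
    refine Finset.sum_congr rfl fun j _ => Finset.sum_congr rfl fun l _ => ?_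
    rw [← Complex.mul_re, map_mul]
    congr 1
    ring
  have hle : ∀ j l, c * (u j * conj (u l)).re - c * |(u j * conj (u l)).im| ≤
      (A i j * conj (A k l)).re * (u j * conj (u l)).re -
        (A i j * conj (A k l)).im * (u j * conj (u l)).im := by
    intro j l
    have h1 := mul_le_mul_of_nonneg_right (hA i j k l).2 (hu j l)
    have h2 := le_abs_self ((A i j * conj (A k l)).im * (u j * conj (u l)).im)
    rw [abs_mul] at h2
    have h3 := mul_le_mul_of_nonneg_right (hA i j k l).1.le (abs_nonneg (u j * conj (u l)).im)
    linarith
  have hpos : 0 < Complex.normSq (∑ i, u i) :=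
    Complex.normSq_pos.2 (sum_ne_zero_of_mem_complexOrthant hu hu0)
  have hlow : ∑ j, ∑ l, (c * (u j * conj (u l)).re - c * |(u j * conj (u l)).im|) =
      c * (Complex.normSq (∑ i, u i) - ∑ j, ∑ l, |(u j * conj (u l)).im|) := by
    rw [normSq_sum_eq]
    simp only [Finset.sum_sub_distrib, ← Finset.mul_sum, mul_sub]
  rw [hexp]
  -- Strictness has two sources: if all imaginary parts vanish, the lower bound is `c * normSq (∑ u)
  -- > 0`; otherwise `|Im| < c` is strict at a pair with nonzero imaginary part.
  by_cases him : ∀ j l, (u j * conj (u l)).im = 0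
  · refine lt_of_lt_of_le ?_ (Finset.sum_le_sum fun j _ => Finset.sum_le_sum fun l _ => hle j l)
    rw [hlow]
    simpa [him] using mul_pos hc hpos
  · push Not at him
    obtain ⟨j₀, l₀, h0⟩ := him
    refine lt_of_le_of_lt (b := ∑ j, ∑ l,
      (c * (u j * conj (u l)).re - c * |(u j * conj (u l)).im|)) ?_ ?_
    · rw [hlow]
      exact mul_nonneg hc.le (sub_nonneg.2 (sum_abs_im_le hu))
    · refine Finset.sum_lt_sum (fun j _ => Finset.sum_le_sum fun l _ => hle j l)
        ⟨j₀, Finset.mem_univ _, Finset.sum_lt_sum (fun l _ => hle j₀ l)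
          ⟨l₀, Finset.mem_univ _, ?_⟩⟩
      have h1 := mul_le_mul_of_nonneg_right (hA i j₀ k l₀).2 (hu j₀ l₀)
      have h2 := le_abs_self ((A i j₀ * conj (A k l₀)).im * (u j₀ * conj (u l₀)).im)
      rw [abs_mul] at h2
      have h3 := mul_lt_mul_of_pos_right (hA i j₀ k l₀).1 (abs_pos.2 h0)
      linarith

end ComplexOrthant

/-! ### Recurrence -/

/-- A continuous self-map of a compact space has a recurrent point. -/
lemma exists_mem_closure_range_iterate_succ {X : Type*} [TopologicalSpace X] [CompactSpace X]
    [Nonempty X] {f : X → X} (hf : Continuous f) :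
    ∃ y, y ∈ closure (Set.range fun k : ℕ => f^[k + 1] y) := by
  -- In a minimal nonempty closed invariant set, the closure of the strict forward orbit of any
  -- point is again such a set, hence contains that point.
  obtain ⟨M, -, hM⟩ := zorn_superset_nonempty
    {s : Set X | IsClosed s ∧ s.Nonempty ∧ Set.MapsTo f s s} (fun C hC hchain hne => by
      refine ⟨⋂₀ C, ⟨isClosed_sInter fun s hs => (hC hs).1, ?_, ?_⟩,
        fun s hs => Set.sInter_subset_of_mem hs⟩
      · have := hne.to_subtype
        exact IsCompact.nonempty_sInter_of_directed_nonempty_isCompact_isClosed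
          (IsChain.directedOn (r := fun s t : Set X => t ⊆ s) hchain.symm) (fun s hs => (hC hs).2.1)
          (fun s hs => (hC hs).1.isCompact) (fun s hs => (hC hs).1)
      · exact fun x hx s hs => (hC hs).2.2 (hx s hs))
    Set.univ ⟨isClosed_univ, Set.univ_nonempty, Set.mapsTo_univ _ _⟩
  obtain ⟨hMc, ⟨y, hy⟩, hMf⟩ := hM.prop
  refine ⟨y, ?_⟩
  have hsub : closure (Set.range fun k : ℕ => f^[k + 1] y) ⊆ M := by
    refine closure_minimal ?_ hMc
    rintro _ ⟨k, rfl⟩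
    exact hMf.iterate (k + 1) hy
  refine hM.le_of_le ⟨isClosed_closure, (Set.range_nonempty _).closure, ?_⟩ hsub hy
  refine Set.MapsTo.closure ?_ hf
  rintro _ ⟨k, rfl⟩
  exact ⟨k + 1, Function.iterate_succ_apply' f (k + 1) y⟩

/-! ### Eigenvectors and the modulus of the other eigenvalues -/

section Eigenvector

variable {ι : Type*} [Fintype ι] {T : (ι → ℂ) →ₗ[ℂ] (ι → ℂ)}

lemma isCompact_orthant_slice :
    IsCompact {u : ι → ℂ | u ∈ complexOrthant ι ∧ ∑ i, u i = 1} := by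
  refine Metric.isCompact_of_isClosed_isBounded ?_ ?_
  · exact isClosed_complexOrthant.inter (isClosed_eq (by fun_prop) continuous_const)
  · refine (Metric.isBounded_closedBall (x := (0 : ι → ℂ)) (r := 1)).subset fun u hu => ?_
    rw [mem_closedBall_zero_iff, pi_norm_le_iff_of_nonneg zero_le_one]
    intro i
    simpa [hu.2] using norm_apply_le_norm_sum hu.1 i

/-- A vector of the slice which is recurrent for the normalized action of `T`. -/
lemma exists_recurrent_vector [Nonempty ι]
    (hT : ∀ u ∈ complexOrthant ι, u ≠ 0 → T u ∈ openComplexOrthant ι) :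
    ∃ y ∈ complexOrthant ι, ∑ i, y i = 1 ∧
      y ∈ closure {w | ∃ (a : ℂ) (k : ℕ), w = a • (T ^ (k + 1)) y} := by
  classical
  set K : Set (ι → ℂ) := {u : ι → ℂ | u ∈ complexOrthant ι ∧ ∑ i, u i = 1}
  have hK0 : ∀ u ∈ K, u ≠ 0 := by
    rintro u hu rfl
    simpa using hu.2
  have hsum : ∀ u ∈ K, ∑ i, T u i ≠ 0 := fun u hu => by
    have h1 := hT u hu.1 (hK0 u hu)
    refine sum_ne_zero_of_mem_complexOrthant (openComplexOrthant_subset h1) fun h0 => ?_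
    simpa [h0] using h1 (Classical.arbitrary ι) (Classical.arbitrary ι)
  have hTc : Continuous T := T.continuous_of_finiteDimensional
  let f : K → K := fun u => ⟨(∑ i, T u i)⁻¹ • T u,
    smul_mem_complexOrthant (openComplexOrthant_subset (hT u u.2.1 (hK0 u u.2))) _, by
      simp only [Pi.smul_apply, smul_eq_mul, ← Finset.mul_sum]
      exact inv_mul_cancel₀ (hsum u u.2)⟩
  have hf : Continuous f := by
    refine Continuous.subtype_mk (Continuous.smul (Continuous.inv₀ ?_ fun u : K => hsum u u.2) ?_) _
    · fun_prop
    · fun_prop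
  have : CompactSpace K := isCompact_iff_compactSpace.1 isCompact_orthant_slice
  let i₀ := Classical.arbitrary ι
  have : Nonempty K := ⟨⟨Pi.single i₀ 1, fun i j => by
    by_cases hi : i = i₀ <;> by_cases hj : j = i₀ <;> simp [hi, hj], by simp⟩⟩
  obtain ⟨y, hy⟩ := exists_mem_closure_range_iterate_succ hf
  refine ⟨y, y.2.1, y.2.2, ?_⟩
  have hiter : ∀ k : ℕ, ∃ a : ℂ, ((f^[k] y : K) : ι → ℂ) = a • (T ^ k) y := by
    intro k
    induction k with
    | zero => exact ⟨1, by simp⟩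
    | succ k ih =>
      obtain ⟨a, ha⟩ := ih
      rw [Function.iterate_succ_apply']
      refine ⟨(∑ i, T (f^[k] y : K) i)⁻¹ * a, ?_⟩
      simp only [f, pow_succ', Module.End.mul_apply, mul_smul]
      rw [ha, map_smul]
  refine map_mem_closure continuous_subtype_val hy ?_
  rintro _ ⟨k, rfl⟩
  obtain ⟨a, ha⟩ := hiter (k + 1)
  exact ⟨a, k, ha⟩

/-- A linear map sending the nonzero vectors of the complex orthant into the open orthant has an
eigenvector in the open orthant. -/
lemma exists_eigenvector_mem_openComplexOrthant [Nonempty ι]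
    (hT : ∀ u ∈ complexOrthant ι, u ≠ 0 → T u ∈ openComplexOrthant ι) :
    ∃ v ∈ openComplexOrthant ι, ∃ ev : ℂ, ev ≠ 0 ∧ T v = ev • v := by
  obtain ⟨y, hyC, hy1, hrec⟩ := exists_recurrent_vector hT
  have hy0 : y ≠ 0 := by
    rintro rfl
    simp at hy1
  have hTc : Continuous T := T.continuous_of_finiteDimensional
  set s : ℂ := ∑ i, T y i with hs
  set p : ι → ℂ := T y - s • y with hp
  have hp0 : ∑ i, p i = 0 := by
    simp [hp, Finset.sum_sub_distrib, ← Finset.mul_sum, hy1, hs]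
  have hq1 : ∀ z : ℂ, ∑ i, (y + z • p) i = 1 := fun z => by
    simp [Finset.sum_add_distrib, ← Finset.mul_sum, hy1, hp0]
  have hq0 : ∀ z : ℂ, y + z • p ≠ 0 := fun z h => by
    have h1 := hq1 z
    rw [h] at h1
    simp at h1
  have hpow : ∀ u ∈ complexOrthant ι, ∀ k : ℕ, (T ^ k) u ∈ complexOrthant ι := by
    intro u hu k
    induction k with
    | zero => simpa using hu
    | succ k ih =>
      rw [pow_succ', Module.End.mul_apply]
      rcases eq_or_ne ((T ^ k) u) 0 with h0 | h0
      · rw [h0, map_zero, ← h0]; exact ih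
      · exact openComplexOrthant_subset (hT _ ih h0)
  -- `y + z • p = B y` with `B` a polynomial in `T`. By recurrence `B y` is a limit of multiples of
  -- `T ^ k (T (B y))`; the exponent `k + 1` leaves the one `T` needed here.
  have hback : ∀ z : ℂ, T (y + z • p) ∈ complexOrthant ι → y + z • p ∈ complexOrthant ι := by
    intro z hz
    set B : (ι → ℂ) →ₗ[ℂ] (ι → ℂ) := (1 : Module.End ℂ (ι → ℂ)) + z • (T - s • 1) with hB
    have hBT : Commute B T := by
      refine (Commute.one_left T).add_left (Commute.smul_left ?_ z)
      exact (Commute.refl T).sub_left ((Commute.one_left T).smul_left s)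
    have hBy : B y = y + z • p := by simp [hB, hp]
    have hBc : Continuous B := B.continuous_of_finiteDimensional
    rw [← hBy] at hz ⊢
    refine closure_minimal (fun _ h => h) isClosed_complexOrthant
      (map_mem_closure hBc hrec ?_)
    rintro _ ⟨a, k, rfl⟩
    have : B ((T ^ (k + 1)) y) = (T ^ k) (T (B y)) := by
      rw [← Module.End.mul_apply, (hBT.pow_right (k + 1)).eq, pow_succ]
      rfl
    rw [map_smul, this]
    exact smul_mem_complexOrthant (hpow _ hz k) a
  -- Membership of `y + z • p` in the closed orthant is equivalent to membership of its image in the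
  -- open one, so the condition is both closed and open in `z`.
  have hclopen : IsClopen {z : ℂ | y + z • p ∈ complexOrthant ι} := by
    constructor
    · exact isClosed_complexOrthant.preimage (by fun_prop)
    · have : {z : ℂ | y + z • p ∈ complexOrthant ι} =
          {z : ℂ | T (y + z • p) ∈ openComplexOrthant ι} :=
        Set.ext fun z => ⟨fun h => hT _ h (hq0 z), fun h => hback z (openComplexOrthant_subset h)⟩
      rw [this]
      exact isOpen_openComplexOrthant.preimage (by fun_prop)
  have huniv := hclopen.eq_univ ⟨0, by simpa using hyC⟩
  have hpz : p = 0 := by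
    funext i
    by_contra hne
    -- This `z` makes the coordinate `i` equal to 2, while the coordinate sum 1 bounds it by 1.
    have hz := norm_apply_le_norm_sum (huniv.ge (Set.mem_univ ((2 - y i) / p i))) i
    rw [hq1] at hz
    have h2 : (y + ((2 - y i) / p i) • p) i = 2 := by
      simp [div_mul_cancel₀ _ hne]
    rw [h2] at hz
    norm_num at hz
  have hTy : T y = s • y := sub_eq_zero.1 hpz
  have hTo := hT y hyC hy0
  have hs0 : s ≠ 0 := by
    intro h0
    rw [hTy, h0, zero_smul] at hTo
    simpa using hTo (Classical.arbitrary ι) (Classical.arbitrary ι)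
  exact ⟨T y, hTo, s, hs0, by rw [hTy, map_smul, hTy]⟩

/-- Eigenvectors annihilated by a functional from the open orthant belong to eigenvalues of smaller
modulus than the one with an eigenvector in the open orthant. -/
lemma norm_lt_of_dotProduct_eq_zero
    (hT : ∀ u ∈ complexOrthant ι, u ≠ 0 → T u ∈ openComplexOrthant ι)
    {v w l : ι → ℂ} {ev μ : ℂ} (hv : v ∈ openComplexOrthant ι) (hev : ev ≠ 0)
    (hTv : T v = ev • v) (hl : l ∈ openComplexOrthant ι) (hw0 : w ≠ 0) (hTw : T w = μ • w)
    (hlw : l ⬝ᵥ w = 0) : ‖μ‖ < ‖ev‖ := by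
  by_contra! hle
  obtain ⟨i, hi⟩ := Function.ne_iff.1 hw0
  have hv0 : v ≠ 0 := by
    rintro rfl
    simpa using hv i i
  have hlv : l ⬝ᵥ v ≠ 0 := dotProduct_ne_zero hl (openComplexOrthant_subset hv) hv0
  have hq0 : ∀ z : ℂ, v + z • w ≠ 0 := fun z h => hlv <| by
    have : l ⬝ᵥ (v + z • w) = 0 := by rw [h, dotProduct_zero]
    simpa [dotProduct_add, dotProduct_smul, hlw] using this
  set S : Set ℂ := {z | v + z • w ∈ complexOrthant ι} with hS
  have hSclosed : IsClosed S := isClosed_complexOrthant.preimage (by fun_prop)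
  -- Were `S` unbounded, rescaling `v + z • w` by `z⁻¹` would put `w` itself in the orthant,
  -- contradicting `l ⬝ᵥ w = 0`.
  have hSbdd : Bornology.IsBounded S := by
    by_contra hnb
    have hseq : ∀ n : ℕ, ∃ z ∈ S, (n : ℝ) + 1 < ‖z‖ := by
      intro n
      by_contra! h
      exact hnb (isBounded_iff_forall_norm_le.2 ⟨_, h⟩)
    choose z hzS hz using hseq
    have hz0 : ∀ n, z n ≠ 0 := fun n h => by
      have := hz n
      rw [h, norm_zero] at this
      linarith [(Nat.cast_nonneg n : (0 : ℝ) ≤ n)]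
    have hlim : Filter.Tendsto (fun n => (z n)⁻¹ • v + w) Filter.atTop
        (nhds ((0 : ℂ) • v + w)) := by
      refine Filter.Tendsto.add_const w (Filter.Tendsto.smul_const ?_ v)
      refine Filter.tendsto_inv₀_cobounded.comp ?_
      rw [← tendsto_norm_atTop_iff_cobounded]
      refine Filter.tendsto_atTop_mono (fun n => (hz n).le) ?_
      exact Filter.tendsto_atTop_add_const_right _ _ tendsto_natCast_atTop_atTop
    rw [zero_smul, zero_add] at hlim
    have hwC : w ∈ complexOrthant ι :=
      isClosed_complexOrthant.mem_of_tendsto hlim <| Filter.Eventually.of_forall fun n => by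
        have := smul_mem_complexOrthant (hzS n) (z n)⁻¹
        rwa [smul_add, smul_smul, inv_mul_cancel₀ (hz0 n), one_smul] at this
    exact dotProduct_ne_zero hl hwC hw0 hlw
  have hScompact : IsCompact S := Metric.isCompact_of_isClosed_isBounded hSclosed hSbdd
  obtain ⟨z₀, hz₀, hmax⟩ := hScompact.exists_isMaxOn
    ⟨0, by simpa [hS] using openComplexOrthant_subset hv⟩ continuous_norm.continuousOn
  -- `ev⁻¹ • T` acts on the parameter as multiplication by `μ / ev` and sends `S` into its interior.
  -- If `‖μ‖ ≥ ‖ev‖`, a point of maximal modulus cannot exist.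
  have hz₁ : v + (μ / ev * z₀) • w ∈ openComplexOrthant ι := by
    have h1 := smul_mem_openComplexOrthant (hT _ hz₀ (hq0 z₀)) (inv_ne_zero hev)
    rw [map_add, map_smul, hTv, hTw, smul_add, smul_smul, inv_mul_cancel₀ hev, one_smul,
      smul_smul, smul_smul] at h1
    rwa [show μ / ev * z₀ = ev⁻¹ * z₀ * μ by ring]
  have hlarge : ‖z₀‖ ≤ ‖μ / ev * z₀‖ := by
    rw [norm_mul, norm_div]
    exact le_mul_of_one_le_left (norm_nonneg _)
      ((one_le_div (norm_pos_iff.2 hev)).2 hle)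
  have hopen : IsOpen {z : ℂ | v + z • w ∈ openComplexOrthant ι} :=
    isOpen_openComplexOrthant.preimage (by fun_prop)
  obtain ⟨ε, hε, hball⟩ := Metric.isOpen_iff.1 hopen _ hz₁
  obtain ⟨d, hd, hdn⟩ : ∃ d : ℂ, ‖d‖ < ε ∧ ‖μ / ev * z₀‖ < ‖μ / ev * z₀ + d‖ := by
    generalize μ / ev * z₀ = a
    rcases eq_or_ne a 0 with ha | ha
    · refine ⟨((ε / 2 : ℝ) : ℂ), ?_, ?_⟩
      · rw [Complex.norm_real, Real.norm_of_nonneg (by positivity)]; linarith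
      · rw [ha, zero_add, norm_zero, Complex.norm_real, Real.norm_of_nonneg (by positivity)]
        positivity
    · have hapos := norm_pos_iff.2 ha
      refine ⟨((ε / 2 / ‖a‖ : ℝ) : ℂ) * a, ?_, ?_⟩
      · rw [norm_mul, Complex.norm_real, Real.norm_of_nonneg (by positivity),
          div_mul_cancel₀ _ hapos.ne']
        linarith
      · have h1 : a + ((ε / 2 / ‖a‖ : ℝ) : ℂ) * a = ((1 + ε / 2 / ‖a‖ : ℝ) : ℂ) * a := by
          push_cast; ring
        rw [h1, norm_mul, Complex.norm_real, Real.norm_of_nonneg (by positivity)]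
        exact lt_mul_of_one_lt_left hapos (lt_add_of_pos_right _ (by positivity))
  have hmem : μ / ev * z₀ + d ∈ S :=
    openComplexOrthant_subset (hball (by simpa [Metric.mem_ball, dist_eq_norm] using hd))
  exact absurd (hmax hmem) (by simpa using lt_of_le_of_lt hlarge hdn)

end Eigenvector

/-! ### Simplicity and the spectral gap -/

/-- If every eigenvector for `ev` in the kernel of an invariant functional `φ` vanishes, and `v` is
an eigenvector with `φ v ≠ 0`, then the generalized eigenspace is spanned by `v`. -/
lemma maxGenEigenspace_eq_span {K V : Type*} [Field K] [AddCommGroup V] [Module K V]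
    {T : Module.End K V} {φ : V →ₗ[K] K} {ev : K} {v : V} (hTv : T v = ev • v) (hφv : φ v ≠ 0)
    (hφ : ∀ w, φ (T w) = ev * φ w) (hker : ∀ w, T w = ev • w → φ w = 0 → w = 0) :
    T.maxGenEigenspace ev = Submodule.span K {v} := by
  have hnil : ∀ (k : ℕ) (w : V), ((T - ev • 1) ^ k) w = 0 → φ w = 0 → w = 0 := by
    intro k
    induction k with
    | zero => intro w hw _; simpa using hw
    | succ k ih =>
      intro w hw hφw
      rw [pow_succ, Module.End.mul_apply] at hw
      have h1 := ih _ hw (by simp [hφ, hφw])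
      exact hker w (by simpa [sub_eq_zero] using h1) hφw
  have hv : v ∈ T.maxGenEigenspace ev :=
    (Module.End.mem_maxGenEigenspace T ev v).2 ⟨1, by simp [hTv]⟩
  refine le_antisymm (fun w hw => ?_) ((Submodule.span_singleton_le_iff_mem _ _).2 hv)
  -- Subtracting this multiple of `v` lands in the kernel of `φ`, where `T - ev • 1` is injective.
  have hw' := Submodule.sub_mem _ hw (Submodule.smul_mem _ (φ w / φ v) hv)
  obtain ⟨k, hk⟩ := (Module.End.mem_maxGenEigenspace T ev _).1 hw'
  have h0 := hnil k _ hk (by simp [div_mul_cancel₀ _ hφv])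
  exact Submodule.mem_span_singleton.2 ⟨φ w / φ v, (sub_eq_zero.1 h0).symm⟩

theorem mainTheorem5 (n : ℕ) (hn : 0 < n) (A : Matrix (Fin n) (Fin n) ℂ) (c : ℝ) (hc : 0 < c)
    (hA : ∀ i j k l : Fin n,
      |(A i j * conj (A k l)).im| < c ∧ c ≤ (A i j * conj (A k l)).re) :
    A.HasSpectralGap := by
  have : Nonempty (Fin n) := ⟨⟨0, hn⟩⟩
  have hT : ∀ u ∈ complexOrthant (Fin n), u ≠ 0 →
      Matrix.toLin' A u ∈ openComplexOrthant (Fin n) := fun u hu hu0 => by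
    rw [Matrix.toLin'_apply]
    exact mulVec_mem_openComplexOrthant hc hA hu hu0
  have hT' : ∀ u ∈ complexOrthant (Fin n), u ≠ 0 →
      Matrix.toLin' A.transpose u ∈ openComplexOrthant (Fin n) := fun u hu hu0 => by
    rw [Matrix.toLin'_apply]
    exact mulVec_mem_openComplexOrthant hc (fun i j k l => hA j i l k) hu hu0
  obtain ⟨v, hv, ev, hev, hTv⟩ := exists_eigenvector_mem_openComplexOrthant hT
  obtain ⟨l, hl, ev', -, hTl⟩ := exists_eigenvector_mem_openComplexOrthant hT'
  have hv0 : v ≠ 0 := by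
    rintro rfl
    simpa using hv ⟨0, hn⟩ ⟨0, hn⟩
  have hlv : l ⬝ᵥ v ≠ 0 := dotProduct_ne_zero hl (openComplexOrthant_subset hv) hv0
  have hinv' : ∀ w, l ⬝ᵥ Matrix.toLin' A w = ev' * l ⬝ᵥ w := fun w => by
    rw [Matrix.toLin'_apply, Matrix.dotProduct_mulVec, ← Matrix.mulVec_transpose,
      ← Matrix.toLin'_apply, hTl, smul_dotProduct, smul_eq_mul]
  obtain rfl : ev = ev' := by
    have h := hinv' v
    rw [hTv, dotProduct_smul, smul_eq_mul] at h
    exact mul_right_cancel₀ hlv h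
  have hsmall : ∀ (w : Fin n → ℂ) (μ : ℂ), w ≠ 0 → Matrix.toLin' A w = μ • w → l ⬝ᵥ w = 0 →
      ‖μ‖ < ‖ev‖ := fun w μ hw0 hw hlw =>
    norm_lt_of_dotProduct_eq_zero hT hv hev hTv hl hw0 hw hlw
  have heig : Module.End.HasEigenvalue (Matrix.toLin' A) ev :=
    Module.End.hasEigenvalue_of_hasEigenvector
      ⟨Module.End.mem_eigenspace_iff.2 hTv, hv0⟩
  have hspec : ev ∈ spectrum ℂ A := by
    rw [← Matrix.spectrum_toLin']
    exact heig.mem_spectrum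
  have hother : ∀ μ ∈ spectrum ℂ A \ {ev}, ‖μ‖₊ < ‖ev‖₊ := by
    rintro μ ⟨hμ, hne⟩
    rw [← Matrix.spectrum_toLin'] at hμ
    obtain ⟨w, hw, hw0⟩ := (Module.End.HasEigenvalue.of_mem_spectrum hμ).exists_hasEigenvector
    have hw := Module.End.mem_eigenspace_iff.1 hw
    refine hsmall w μ hw0 hw ?_
    have h := hinv' w
    rw [hw, dotProduct_smul, smul_eq_mul] at h
    by_contra h0
    exact hne (mul_right_cancel₀ h0 h)
  have hrad : (‖ev‖₊ : ℝ≥0∞) = spectralRadius ℂ A := by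
    refine le_antisymm (le_iSup₂_of_le ev hspec le_rfl) (iSup₂_le fun μ hμ => ?_)
    rcases eq_or_ne μ ev with rfl | hne
    · exact le_rfl
    · exact ENNReal.coe_le_coe.2 (hother μ ⟨hμ, hne⟩).le
  refine ⟨ev, ⟨heig, ?_⟩, hrad, ?_⟩
  · have hspan : Module.End.maxGenEigenspace (Matrix.toLin' A) ev = Submodule.span ℂ {v} := by
      -- An eigenvector for `ev` killed by `l` would give `‖ev‖ < ‖ev‖`.
      refine maxGenEigenspace_eq_span (φ := dotProductBilin ℂ ℂ l) hTv hlv hinv' fun w hw hlw => ?_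
      by_contra hw0
      exact lt_irrefl _ (hsmall w ev hw0 hw hlw)
    rw [← Matrix.charpoly_toLin', ← LinearMap.finrank_maxGenEigenspace_eq, hspan,
      finrank_span_singleton hv0]
  · have hfin : (spectrum ℂ A \ {ev}).Finite := (Matrix.finite_spectrum A).sdiff
    -- The radius is the largest remaining modulus. If no eigenvalue remains it is 0, which is why
    -- `ev ≠ 0` is needed.
    refine ⟨hfin.toFinset.sup fun μ => ‖μ‖₊, ?_, fun μ hμ => ?_⟩
    · rw [← hrad, ENNReal.coe_lt_coe, Finset.sup_lt_iff (by simpa using hev)]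
      exact fun μ hμ => hother μ (hfin.mem_toFinset.1 hμ)
    · exact Finset.le_sup (f := fun μ : ℂ => ‖μ‖₊) (hfin.mem_toFinset.2 hμ)
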